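/- Let $\mathbb F_2$ be the free group on two generators $a,b$ and let $\ell(w)$ be the word length of $w\in\mathbb F_2$ with respect to $\{a,a^{-1},b,b^{-1}\}$. Write $\gamma_1(\mathbb F_2)=\mathbb F_2$, $\gamma_{n+1}(\mathbb F_2)=[\gamma_n(\mathbb F_2),\mathbb F_2]$ $(n\ge 1)$ for the lower central series and $\mathbb F_2^{(0)}=\mathbb F_2$, $\mathbb F_2^{(n+1)}=[\mathbb F_2^{(n)},\mathbb F_2^{(n)}]$ $(n\ge 0)$ for the derived series. All these subgroups are nontrivial; put $$\alpha(n)=\min\{\ell(w): w\in\gamma_n(\mathbb F_2)\setminus\{e\}\}\ (n\ge 1),\qquad \beta(n)=\min\{\ell(w): w\in\mathbb F_2^{(n)}\setminus\{e\}\}\ (n\ge 0).$$ For functions $f,g\colon\mathbb N\to\mathbb R$ write $f(n)\preceq g(n)$ if there is a constant $C\in\mathbb N$ with $f(n)\le C\,g(Cn)$ for all integers $n\ge 1$. Then: 1. The limit $\alpha:=\lim_{n\to\infty}\frac{\log_2\alpha(n)}{\log_2 n}$ exists and $$\alpha\le \nu:=\frac{\log_2(3+\sqrt{17})-1}{\log_2(1+\sqrt2)}=1.4411\ldots;$$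 moreover (equivalently) $\alpha(n)\preceq n^{\nu+\varepsilon}$ for every $\varepsilon>0$. 2. The limit $\beta:=\lim_{n\to\infty}\frac{\log_2\beta(n)}{n}$ exists and $$\log_2 3\le\beta\le \log_2(3+\sqrt{17})-1=1.8325\ldots;$$ moreover (equivalently) $\log_2(3)\cdot n\le\log_2\beta(n)$ for all $n\ge 0$, and $\log_2\beta(n)\le(\log_2(3+\sqrt{17})-1)\cdot n+o(n)$. -/

import Mathlib

open Filter Asymptotics

namespace ShortElements

/-- The free group on two generators. -/
abbrev F2 : Type := FreeGroup (Fin 2)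

/-- The minimal word length of a nontrivial element of a subgroup of the free group;
`FreeGroup.norm w` is the length of the reduced word representing `w`. The infimum is a minimum
as soon as the subgroup is nontrivial. -/
noncomputable def girth (H : Subgroup F2) : ℕ :=
  sInf {k : ℕ | ∃ w ∈ H, w ≠ 1 ∧ w.norm = k}

/-- The lower central series indexed from one: `gamma 1 = F2` and
`gamma (n + 1) = [gamma n, F2]` for `n ≥ 1`. (The value at `n = 0` is not used.) -/
def gamma (n : ℕ) : Subgroup F2 := (⊤ : Subgroup F2).lowerCentralSeries (n - 1)

/-- The shortest length of a nontrivial element of the `n`-th term of the lower central series,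
for `n ≥ 1`. -/
noncomputable def alpha (n : ℕ) : ℕ := girth (gamma n)

/-- The shortest length of a nontrivial element of the `n`-th term of the derived series,
for `n ≥ 0`. -/
noncomputable def beta (n : ℕ) : ℕ := girth (derivedSeries F2 n)

/-- `f ≼ g`: there is a constant `C` such that `f n ≤ C * g (C * n)` for all positive integers
`n`. -/
def Preceq (f g : ℕ → ℝ) : Prop :=
  ∃ C : ℕ, ∀ n : ℕ, 1 ≤ n → f n ≤ C * g (C * n)

/-- The bound for the exponential growth rate of `beta`. -/
noncomputable def betaBound : ℝ := Real.logb 2 (3 + √17) - 1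

/-- The bound for the growth exponent of `alpha`. -/
noncomputable def alphaBound : ℝ := (Real.logb 2 (3 + √17) - 1) / Real.logb 2 (1 + √2)

end ShortElements

/-!
The two upper bounds come from one endomorphism `phi` of the free group on `a` and `b`, which sends
the generators to the commutators `b⁻¹aba⁻¹` and `aba⁻¹b⁻¹`. It is injective by a ping-pong argument
(`phi_injective`), so its iterates produce nontrivial elements `aₙ`, `bₙ` of the `n`-th derived
subgroup. Every occurrence of `ab` in a word leads to a cancellation in its image; following the
lengths of `aₙ`, `bₙ` and of `aₙbₙ` together, one finds that they grow at most like the powers of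
the larger root `(3 + √17) / 2` of `X² - 3X - 2` (`norm_iter_le`). Since `aₙ₊₁` and `bₙ₊₁` are
conjugate by `bₙ`, their quotient is a commutator of `bₙ⁻¹` and `bₙ₊₁`; hence the next commutator
`⁅aₙ₊₁, bₙ₊₁⁆` lies at depth `2cₙ₊₁ + cₙ` of the lower central series if `aₙ`, `bₙ` lie at depth `cₙ`
(`iter_mem_gamma`), and these depths grow like the powers of `1 + √2`.

The limits exist because the two length functions are submultiplicative up to a constant factor,
`α(mn) ≤ 3 α(m) α(n)` and `β(m + n) ≤ 3 β(m) β(n)` (`alpha_mul_le`, `beta_add_le`): a short element of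
a normal subgroup has two conjugates of almost the same length that freely generate a free group
(`exists_free_pair`), and a short word can be evaluated at these. Fekete's lemma does the rest.

The lower bound is `β(n + 1) ≥ 3 β(n)`. More generally, if all nontrivial elements of a normal
subgroup `H` have length at least `L`, then those of `⁅H, H⁆` have length at least `3L`
(`three_mul_le_norm_of_mem_commutator`). Such an element describes a closed walk without
backtracking in the Cayley graph of the quotient by `H`, a graph of girth at least `L`, and this
walk is homologically trivial: it traverses every edge equally often in both directions, so at least
twice. It cannot stay on a shortest cycle, of length `d ≥ L`, say. If it returns to this cycle after
`k` steps outside, then these steps form closed paths with both arcs of the cycle, so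
`2k + d ≥ 2L`. As `d` is the girth, the first `min k d` of these steps traverse distinct edges. The
graph traversed thus has at least `3L / 2` edges, and the walk has length at least `3L`.
-/

namespace ShortElements

/-! ### A ping-pong criterion for free groups -/

section PingPong

variable {ι G α : Type*} [Group G] [MulAction G α]

/-- The image in `G` of a letter `(i, true)`, standing for the `i`-th generator, or `(i, false)`,
standing for its inverse, when the generators are sent to `g`. -/
def letterImage (g : ι → G) (l : ι × Bool) : G :=
  bif l.2 then g l.1 else (g l.1)⁻¹

/-- The inverse letter. -/
def invLetter (l : ι × Bool) : ι × Bool := (l.1, !l.2)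

@[simp] lemma invLetter_invLetter (l : ι × Bool) : invLetter (invLetter l) = l := by
  simp [invLetter]

lemma invLetter_injective : Function.Injective (invLetter : ι × Bool → ι × Bool) :=
  Function.LeftInverse.injective invLetter_invLetter

lemma invLetter_ne_self (l : ι × Bool) : invLetter l ≠ l := by
  simp [invLetter, Prod.ext_iff]

lemma letterImage_invLetter (g : ι → G) (l : ι × Bool) :
    letterImage g (invLetter l) = (letterImage g l)⁻¹ := by
  rcases l with ⟨i, _ | _⟩ <;> simp [letterImage, invLetter]

lemma ne_invLetter_iff {l m : ι × Bool} : m ≠ invLetter l ↔ (l.1 = m.1 → l.2 = m.2) := by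
  rcases l with ⟨i, _ | _⟩ <;> rcases m with ⟨j, _ | _⟩ <;> simp [invLetter, eq_comm]

lemma lift_mk_cons (g : ι → G) (l : ι × Bool) (L : List (ι × Bool)) :
    FreeGroup.lift g (FreeGroup.mk (l :: L)) =
      letterImage g l * FreeGroup.lift g (FreeGroup.mk L) := by
  simp [FreeGroup.lift_mk, letterImage]

/-- In contrast to `FreeGroup.injective_lift_of_ping_pong`, only the translates of the sets `S m`
and of one base point are controlled, not those of all points outside `S (invLetter l)`. -/
theorem injective_lift_of_letter_ping_pong [DecidableEq ι] (g : ι → G) (S : ι × Bool → Set α)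
    (x : α) (hx : ∀ l, x ∉ S l) (hxS : ∀ l, letterImage g l • x ∈ S l)
    (hS : ∀ l m, m ≠ invLetter l → ∀ y ∈ S m, letterImage g l • y ∈ S l) :
    Function.Injective (FreeGroup.lift g) := by
  have key : ∀ (L : List (ι × Bool)) (l : ι × Bool), FreeGroup.IsReduced (l :: L) →
      FreeGroup.lift g (FreeGroup.mk (l :: L)) • x ∈ S l := by
    intro L
    induction L with
    | nil =>
      intro l _
      rw [lift_mk_cons, ← FreeGroup.one_eq_mk, map_one, mul_one]
      exact hxS l
    | cons m L ih =>
      intro l h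
      rw [lift_mk_cons, mul_smul]
      rw [FreeGroup.isReduced_cons_cons] at h
      exact hS l m (ne_invLetter_iff.2 h.1) _ (ih m h.2)
  rw [injective_iff_map_eq_one]
  intro w hw
  by_contra hne
  obtain ⟨l, L, hL⟩ := List.exists_cons_of_ne_nil (mt FreeGroup.toWord_eq_nil_iff.1 hne)
  have h := key L l (hL ▸ FreeGroup.isReduced_toWord)
  rw [← hL, FreeGroup.mk_toWord, hw, one_smul] at h
  exact hx l h

end PingPong

/-! ### Free pairs of words in the free group -/

section Words

open FreeGroup

/-- The elements of the free group whose reduced word begins with `P`. -/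
def cylinder (P : List (Fin 2 × Bool)) : Set F2 :=
  {w | ∃ T, FreeGroup.IsReduced (P ++ T) ∧ w = mk (P ++ T)}

lemma one_notMem_cylinder {P : List (Fin 2 × Bool)} (hP : P ≠ []) : (1 : F2) ∉ cylinder P := by
  rintro ⟨T, hT, h⟩
  have h2 := congrArg toWord h
  rw [toWord_mk, hT.reduce_eq, toWord_one] at h2
  exact hP (List.append_eq_nil_iff.1 h2.symm).1

lemma isReduced_append_iff {U V : List (Fin 2 × Bool)} :
    FreeGroup.IsReduced (U ++ V) ↔ FreeGroup.IsReduced U ∧ FreeGroup.IsReduced V ∧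
      ∀ x ∈ U.getLast?, ∀ y ∈ V.head?, y ≠ invLetter x := by
  simp only [FreeGroup.IsReduced, List.isChain_append, ne_invLetter_iff]

/-- The endomorphism sending the two generators `a` and `b` of the free group to the commutators
`b⁻¹aba⁻¹` and `aba⁻¹b⁻¹`. -/
def phi : F2 →* F2 :=
  FreeGroup.lift ![(of 1)⁻¹ * of 0 * of 1 * (of 0)⁻¹, of 0 * of 1 * (of 0)⁻¹ * (of 1)⁻¹]

/-- The first two letters of the image under `phi` of a letter; they are never cancelled in the
image under `phi` of a reduced word beginning with that letter. -/
def phiPrefix : Fin 2 × Bool → List (Fin 2 × Bool)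
  | (0, true) => [(1, false), (0, true)]
  | (0, false) => [(0, true), (1, false)]
  | (1, true) => [(0, true), (1, true)]
  | (1, false) => [(1, true), (0, true)]

lemma mk_cons_cancel (U : List (Fin 2 × Bool)) (l : Fin 2 × Bool) (T : List (Fin 2 × Bool)) :
    (mk (U ++ [l]) : F2) * mk (invLetter l :: T) = mk (U ++ T) := by
  rw [mul_mk, List.append_assoc, List.singleton_append]
  exact Quot.sound Red.Step.not

lemma letterImage_phi (l : Fin 2 × Bool) :
    letterImage (![(of 1)⁻¹ * of 0 * of 1 * (of 0)⁻¹, of 0 * of 1 * (of 0)⁻¹ * (of 1)⁻¹] :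
      Fin 2 → F2) l = (mk (match l with
        | (0, true) => [(1, false), (0, true), (1, true), (0, false)]
        | (0, false) => [(0, true), (1, false), (0, false), (1, true)]
        | (1, true) => [(0, true), (1, true), (0, false), (1, false)]
        | (1, false) => [(1, true), (0, true), (1, false), (0, false)]) : F2) := by
  rcases l with ⟨i, b⟩
  fin_cases i <;> cases b <;> simp [letterImage, of, inv_mk, mul_mk, invRev]

theorem phi_injective : Function.Injective phi := by
  refine injective_lift_of_letter_ping_pong _ (fun l => cylinder (phiPrefix l)) 1
    (fun l => one_notMem_cylinder ?_) ?_ ?_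
  · rcases l with ⟨i, b⟩
    fin_cases i <;> cases b <;> simp [phiPrefix]
  · intro l
    rw [letterImage_phi, smul_eq_mul, mul_one]
    rcases l with ⟨i, b⟩
    fin_cases i <;> cases b <;>
      exact ⟨[_, _], by simp [phiPrefix, isReduced_cons_cons], rfl⟩
  · rintro l m h _ ⟨T, hT, rfl⟩
    rw [letterImage_phi, smul_eq_mul]
    rcases l with ⟨i, b⟩
    rcases m with ⟨j, c⟩
    -- a letter is cancelled only between the images of `a` and `b`, or of `b⁻¹` and `a⁻¹`
    by_cases h1 : ((i, b), (j, c)) = (((0, true), (1, true)) : (Fin 2 × Bool) × (Fin 2 × Bool))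
    · obtain ⟨⟨rfl, rfl⟩, rfl, rfl⟩ := by simpa using h1
      refine ⟨(1, true) :: (1, true) :: T, ?_, mk_cons_cancel [_, _, _] (0, false) _⟩
      simpa [phiPrefix, isReduced_cons_cons] using hT
    by_cases h2 : ((i, b), (j, c)) = (((1, false), (0, false)) : (Fin 2 × Bool) × (Fin 2 × Bool))
    · obtain ⟨⟨rfl, rfl⟩, rfl, rfl⟩ := by simpa using h2
      refine ⟨(1, false) :: (1, false) :: T, ?_, mk_cons_cancel [_, _, _] (0, false) _⟩
      simpa [phiPrefix, isReduced_cons_cons] using hT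
    fin_cases i <;> cases b <;> fin_cases j <;> cases c <;>
      first
      | exact absurd rfl h
      | exact absurd rfl h1
      | exact absurd rfl h2
      | exact ⟨_ :: _ :: (phiPrefix _ ++ T),
          by simpa [phiPrefix, isReduced_cons_cons] using hT, rfl⟩

/-- The subgroup generated by two conjugates `sUs⁻¹` and `tUt⁻¹` of a cyclically reduced word `U`
is free on them if `s` and `t` are distinct letters for which both products are reduced: the
cylinders played with are those of the first two letters of the conjugates and their inverses. -/
theorem injective_lift_conj {U : List (Fin 2 × Bool)} (hU : IsCyclicallyReduced U)
    {x z : Fin 2 × Bool} (hx : x ∈ U.head?) (hz : z ∈ U.getLast?) (s : Fin 2 → Fin 2 × Bool)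
    (hs : s 0 ≠ s 1) (hsx : ∀ i, s i ≠ invLetter x) (hsz : ∀ i, s i ≠ z) :
    Function.Injective (FreeGroup.lift fun i : Fin 2 =>
      (mk [s i] * mk U * (mk [s i])⁻¹ : F2)) := by
  have hinj : Function.Injective s := by
    intro i j h
    fin_cases i <;> fin_cases j <;> simp_all
  -- `V l` is `U` or its inverse, with first letter `f l` and last letter `g l`
  let V : Fin 2 × Bool → List (Fin 2 × Bool) := fun l => bif l.2 then U else invRev U
  let f : Fin 2 × Bool → Fin 2 × Bool := fun l => bif l.2 then x else invLetter z
  let g : Fin 2 × Bool → Fin 2 × Bool := fun l => bif l.2 then z else invLetter x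
  have hinv : (invRev U).head? = some (invLetter z) ∧ (invRev U).getLast? = some (invLetter x) := by
    rw [Option.mem_def] at hx hz
    simp [invRev, invLetter, List.head?_reverse, List.getLast?_reverse, hx, hz]
  have hVf : ∀ l, (V l).head? = some (f l) := by
    rintro ⟨i, _ | _⟩
    · exact hinv.1
    · exact hx
  have hVg : ∀ l, (V l).getLast? = some (g l) := by
    rintro ⟨i, _ | _⟩
    · exact hinv.2
    · exact hz
  have hVred : ∀ l, FreeGroup.IsReduced (V l) := by
    rintro ⟨i, _ | _⟩
    · exact IsReduced.of_reduce_eq (by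
        change reduce (invRev U) = invRev U
        rw [reduce_invRev, hU.isReduced.reduce_eq])
    · exact hU.isReduced
  have hxz : x ≠ invLetter z := ne_invLetter_iff.2 (hU.2 z hz x hx)
  have hgs : ∀ l i, invLetter (s i) ≠ invLetter (g l) := by
    rintro ⟨j, _ | _⟩ i h <;> have h := congrArg invLetter h <;>
      rw [invLetter_invLetter, invLetter_invLetter] at h
    · exact hsx i h
    · exact hsz i h
  have hfs : ∀ l i, f l ≠ invLetter (s i) := by
    rintro ⟨j, _ | _⟩ i h
    · exact hsz i (invLetter_injective h.symm)
    · exact hsx i (by rw [show x = invLetter (s i) from h, invLetter_invLetter])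
  have hfg : ∀ l, f l ≠ invLetter (g l) := by
    rintro ⟨j, _ | _⟩ h
    · exact hxz (by rw [show invLetter z = _ from h]; exact (invLetter_invLetter x).symm)
    · exact hxz h
  have hss : ∀ i j, i ≠ j → s j ≠ invLetter (invLetter (s i)) := by
    intro i j hij h
    rw [invLetter_invLetter] at h
    exact hij (hinj h).symm
  have himg : ∀ l, letterImage (fun i : Fin 2 => (mk [s i] * mk U * (mk [s i])⁻¹ : F2)) l =
      mk ((s l.1 :: V l) ++ [invLetter (s l.1)]) := by
    rintro ⟨i, _ | _⟩ <;> simp [letterImage, V, inv_mk, mul_mk, invRev, invLetter]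
  have hcons : ∀ l, ∃ T, V l = f l :: T := fun l => List.head?_eq_some_iff.1 (hVf l)
  have hsV : ∀ l, FreeGroup.IsReduced (s l.1 :: V l) := by
    intro l
    rw [← List.singleton_append, isReduced_append_iff]
    refine ⟨.singleton, hVred l, ?_⟩
    simpa [hVf] using hfs l l.1
  have hlast : ∀ l, (s l.1 :: V l).getLast? = some (g l) := by
    intro l
    simp [List.getLast?_cons, hVg]
  have hfull : ∀ l, FreeGroup.IsReduced ((s l.1 :: V l) ++ [invLetter (s l.1)]) := by
    intro l
    rw [isReduced_append_iff, hlast]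
    refine ⟨hsV l, .singleton, ?_⟩
    simpa using hgs l l.1
  refine injective_lift_of_letter_ping_pong _ (fun l => cylinder [s l.1, f l]) 1
    (fun l => one_notMem_cylinder (by simp)) ?_ ?_
  · intro l
    obtain ⟨T, hT⟩ := hcons l
    rw [himg, smul_eq_mul, mul_one]
    refine ⟨T ++ [invLetter (s l.1)], ?_, by simp [hT]⟩
    simpa [hT] using hfull l
  · rintro l m h _ ⟨T, hT, rfl⟩
    obtain ⟨R, hR⟩ := hcons l
    rw [himg, smul_eq_mul]
    by_cases hlm : l.1 = m.1
    · obtain rfl : l = m := Prod.ext hlm (ne_invLetter_iff.1 h hlm)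
      refine ⟨R ++ f l :: T, ?_, ?_⟩
      · have : [s l.1, f l] ++ (R ++ f l :: T) = (s l.1 :: V l) ++ f l :: T := by simp [hR]
        rw [this, isReduced_append_iff, hlast]
        refine ⟨hsV l, hT.infix ⟨[s l.1], [], by simp⟩, ?_⟩
        simpa using hfg l
      · have := mk_cons_cancel (s l.1 :: V l) (invLetter (s l.1)) (f l :: T)
        rw [invLetter_invLetter] at this
        simpa [hR] using this
    · refine ⟨R ++ [invLetter (s l.1)] ++ ([s m.1, f m] ++ T), ?_, by simp [mul_mk, hR]⟩
      have : [s l.1, f l] ++ (R ++ [invLetter (s l.1)] ++ ([s m.1, f m] ++ T)) =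
          ((s l.1 :: V l) ++ [invLetter (s l.1)]) ++ ([s m.1, f m] ++ T) := by simp [hR]
      rw [this, isReduced_append_iff]
      refine ⟨hfull l, hT, ?_⟩
      rw [List.getLast?_concat]
      simpa using hss l.1 m.1 hlm

lemma exists_isCyclicallyReduced {H : Subgroup F2} [H.Normal] {w : F2} (hw : w ∈ H)
    (hw1 : w ≠ 1) :
    ∃ U : List (Fin 2 × Bool), IsCyclicallyReduced U ∧ U ≠ [] ∧ (mk U : F2) ∈ H ∧
      U.length ≤ w.norm := by
  set L := w.toWord with hL
  set C := reduceCyclically.conjugator L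
  set U := reduceCyclically L
  have hLU : C ++ U ++ invRev C = L := reduceCyclically.conj_conjugator_reduceCyclically L
  have hwU : w = mk C * mk U * (mk C)⁻¹ := by
    rw [inv_mk, mul_mk, mul_mk, hLU, hL, mk_toWord]
  refine ⟨U, reduceCyclically.isCyclicallyReduced isReduced_toWord, ?_, ?_, ?_⟩
  · intro h
    rw [h, ← one_eq_mk, mul_one, mul_inv_cancel] at hwU
    exact hw1 hwU
  · have h := ‹H.Normal›.conj_mem w hw (mk C)⁻¹
    rw [hwU] at h
    convert h using 1
    group
  · have := congrArg List.length hLU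
    simp only [List.length_append] at this
    have h2 : w.norm = L.length := rfl
    omega

/-- A nontrivial element of a normal subgroup gives two free generators of a free subgroup of it
whose lengths exceed that of the given element by at most two. -/
theorem exists_free_pair {H : Subgroup F2} [H.Normal] {w : F2} (hw : w ∈ H) (hw1 : w ≠ 1) :
    ∃ u : Fin 2 → F2, (∀ i, u i ∈ H) ∧ (∀ i, (u i).norm ≤ w.norm + 2) ∧
      Function.Injective (FreeGroup.lift u) := by
  obtain ⟨U, hU, hU0, hUH, hUw⟩ := exists_isCyclicallyReduced hw hw1
  obtain ⟨s, hs, hsx, hsz⟩ : ∃ s : Fin 2 → Fin 2 × Bool, s 0 ≠ s 1 ∧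
      (∀ i, s i ≠ invLetter (U.head hU0)) ∧ ∀ i, s i ≠ U.getLast hU0 := by
    generalize U.head hU0 = x
    generalize U.getLast hU0 = z
    revert x z
    decide
  refine ⟨fun i => mk [s i] * mk U * (mk [s i])⁻¹, fun i => ‹H.Normal›.conj_mem _ hUH _, ?_,
    injective_lift_conj hU (List.head_mem_head? hU0) (List.getLast_mem_getLast? hU0) s hs hsx hsz⟩
  intro i
  have h0 : (mk U : F2).norm ≤ w.norm := norm_mk_le.trans hUw
  have h1 : (mk [s i] : F2).norm ≤ 1 := norm_mk_le
  have h2 := norm_mul_le (mk [s i] * mk U : F2) (mk [s i])⁻¹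
  have h3 := norm_mul_le (mk [s i] : F2) (mk U)
  rw [norm_inv_eq] at h2
  show (mk [s i] * mk U * (mk [s i])⁻¹ : F2).norm ≤ _
  omega

end Words

open FreeGroup (of mk)
open scoped commutatorElement Topology

/-! ### Submultiplicativity of the two length functions -/

lemma girth_le {H : Subgroup F2} {w : F2} (hw : w ∈ H) (hw1 : w ≠ 1) : girth H ≤ w.norm :=
  Nat.sInf_le ⟨w, hw, hw1, rfl⟩

lemma exists_norm_eq_girth {H : Subgroup F2} (hH : ∃ w ∈ H, w ≠ 1) :
    ∃ w ∈ H, w ≠ 1 ∧ w.norm = girth H := by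
  obtain ⟨w, hw, hw1⟩ := hH
  exact Nat.sInf_mem (s := {k : ℕ | ∃ w ∈ H, w ≠ 1 ∧ w.norm = k}) ⟨_, w, hw, hw1, rfl⟩

lemma girth_pos {H : Subgroup F2} (hH : ∃ w ∈ H, w ≠ 1) : 0 < girth H := by
  obtain ⟨w, -, hw1, hn⟩ := exists_norm_eq_girth hH
  rw [← hn, Nat.pos_iff_ne_zero, Ne, FreeGroup.norm_eq_zero]
  exact hw1

lemma norm_lift_le (u : Fin 2 → F2) (k : ℕ) (hu : ∀ i, (u i).norm ≤ k) (w : F2) :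
    (FreeGroup.lift u w).norm ≤ k * w.norm := by
  have key : ∀ L : List (Fin 2 × Bool), (FreeGroup.lift u (mk L)).norm ≤ k * L.length := by
    intro L
    induction L with
    | nil => rw [← FreeGroup.one_eq_mk, map_one, FreeGroup.norm_one]; simp
    | cons l L ih =>
      rw [lift_mk_cons, List.length_cons, mul_add, mul_one, add_comm]
      refine (FreeGroup.norm_mul_le _ _).trans (add_le_add ?_ ih)
      rcases l with ⟨i, _ | _⟩ <;> simpa [letterImage] using hu i
  have h := key w.toWord
  rwa [FreeGroup.mk_toWord] at h

lemma girth_le_three_mul {H K M : Subgroup F2} [H.Normal] (hH : ∃ w ∈ H, w ≠ 1)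
    (hK : ∃ w ∈ K, w ≠ 1)
    (hM : ∀ u : Fin 2 → F2, (∀ i, u i ∈ H) → ∀ w ∈ K, FreeGroup.lift u w ∈ M) :
    girth M ≤ 3 * girth H * girth K := by
  have hpos := girth_pos hH
  obtain ⟨w, hw, hw1, hwn⟩ := exists_norm_eq_girth hH
  obtain ⟨v, hv, hv1, hvn⟩ := exists_norm_eq_girth hK
  obtain ⟨u, huH, hun, hinj⟩ := exists_free_pair hw hw1
  refine (girth_le (hM u huH v hv) fun h => hv1 (hinj (h.trans (map_one _).symm))).trans ?_
  rw [← hvn]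
  exact norm_lift_le u _ (fun i => (hun i).trans (by omega)) v

section Commutators

variable {G : Type*} [Group G]

/-- The three subgroups lemma relative to a normal subgroup. -/
lemma commutator_commutator_le_of_rotate {A B C N : Subgroup G} [N.Normal]
    (h1 : ⁅⁅B, C⁆, A⁆ ≤ N) (h2 : ⁅⁅C, A⁆, B⁆ ≤ N) : ⁅⁅A, B⁆, C⁆ ≤ N := by
  have key : ∀ K : Subgroup G, K ≤ N ↔ K.map (QuotientGroup.mk' N) = ⊥ := by
    intro K
    rw [Subgroup.map_eq_bot_iff, QuotientGroup.ker_mk']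
  rw [key] at h1 h2 ⊢
  rw [Subgroup.map_commutator, Subgroup.map_commutator] at h1 h2 ⊢
  exact Subgroup.commutator_commutator_eq_bot_of_rotate h1 h2

lemma commutator_lowerCentralSeries_le (m n : ℕ) :
    ⁅(⊤ : Subgroup G).lowerCentralSeries m, (⊤ : Subgroup G).lowerCentralSeries n⁆ ≤
      (⊤ : Subgroup G).lowerCentralSeries (m + n + 1) := by
  induction n generalizing m with
  | zero => exact le_rfl
  | succ n ih =>
    rw [Subgroup.commutator_comm, Subgroup.lowerCentralSeries_succ]
    apply commutator_commutator_le_of_rotate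
    · rw [Subgroup.commutator_comm ⊤, ← Subgroup.lowerCentralSeries_succ]
      exact (ih (m + 1)).trans_eq (by congr 1; ring)
    · exact Subgroup.commutator_mono (ih m) le_rfl

lemma lowerCentralSeries_lowerCentralSeries_le (m n : ℕ) :
    ((⊤ : Subgroup G).lowerCentralSeries m).lowerCentralSeries n ≤
      (⊤ : Subgroup G).lowerCentralSeries ((m + 1) * (n + 1) - 1) := by
  induction n with
  | zero => simp
  | succ n ih =>
    rw [Subgroup.lowerCentralSeries_succ]
    refine (Subgroup.commutator_mono ih le_rfl).trans
      ((commutator_lowerCentralSeries_le _ _).trans_eq ?_)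
    congr 1
    have : 1 ≤ (m + 1) * (n + 1) := Nat.succ_le_of_lt (by positivity)
    rw [show (m + 1) * (n + 1 + 1) = (m + 1) * (n + 1) + (m + 1) by ring]
    omega

lemma map_derivedSeries_le_add {G' : Type*} [Group G'] (f : G' →* G) (m n : ℕ)
    (hf : f.range ≤ derivedSeries G m) :
    (derivedSeries G' n).map f ≤ derivedSeries G (m + n) := by
  induction n with
  | zero => rwa [derivedSeries_zero, ← MonoidHom.range_eq_map]
  | succ n ih =>
    rw [derivedSeries_succ, Subgroup.map_commutator, ← add_assoc, derivedSeries_succ]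
    exact Subgroup.commutator_mono ih ih

end Commutators

instance gamma_normal (n : ℕ) : (gamma n).Normal := by
  unfold gamma; infer_instance

lemma gamma_antitone : Antitone gamma := fun _ _ h =>
  Subgroup.lowerCentralSeries_antitone _ (Nat.sub_le_sub_right h 1)

lemma commutator_gamma_le {m n : ℕ} (hm : 1 ≤ m) (hn : 1 ≤ n) :
    ⁅gamma m, gamma n⁆ ≤ gamma (m + n) :=
  (commutator_lowerCentralSeries_le _ _).trans_eq (by unfold gamma; congr 1; omega)

lemma range_lift_le {H : Subgroup F2} {u : Fin 2 → F2} (hu : ∀ i, u i ∈ H) :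
    (FreeGroup.lift u).range ≤ H := by
  apply FreeGroup.range_lift_le
  rintro _ ⟨i, rfl⟩
  exact hu i

lemma lift_mem_gamma {m n : ℕ} (hm : 1 ≤ m) (hn : 1 ≤ n) (u : Fin 2 → F2)
    (hu : ∀ i, u i ∈ gamma m) (w : F2) (hw : w ∈ gamma n) :
    FreeGroup.lift u w ∈ gamma (m * n) := by
  have h := Subgroup.mem_map_of_mem (FreeGroup.lift u) hw
  rw [gamma, Subgroup.map_lowerCentralSeries, ← MonoidHom.range_eq_map] at h
  have h2 := lowerCentralSeries_lowerCentralSeries_le _ _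
    (Subgroup.lowerCentralSeries_mono _ (range_lift_le hu) h)
  rwa [Nat.sub_add_cancel hm, Nat.sub_add_cancel hn] at h2

lemma lift_mem_derivedSeries (m n : ℕ) (u : Fin 2 → F2) (hu : ∀ i, u i ∈ derivedSeries F2 m)
    (w : F2) (hw : w ∈ derivedSeries F2 n) : FreeGroup.lift u w ∈ derivedSeries F2 (m + n) :=
  map_derivedSeries_le_add _ m n (range_lift_le hu) (Subgroup.mem_map_of_mem _ hw)

/-! ### Short elements deep in the two series -/

/-- The image of the first generator under the `n`-th iterate of `phi`. -/
def iterA (n : ℕ) : F2 := phi^[n] (of 0)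

/-- The image of the second generator under the `n`-th iterate of `phi`. -/
def iterB (n : ℕ) : F2 := phi^[n] (of 1)

lemma iterA_succ (n : ℕ) : iterA (n + 1) = (iterB n)⁻¹ * iterA n * iterB n * (iterA n)⁻¹ := by
  simp [iterA, iterB, phi, Function.iterate_succ_apply, -Function.iterate_succ]

lemma iterB_succ (n : ℕ) : iterB (n + 1) = iterA n * iterB n * (iterA n)⁻¹ * (iterB n)⁻¹ := by
  simp [iterA, iterB, phi, Function.iterate_succ_apply, -Function.iterate_succ]

lemma iterB_succ_eq_commutator (n : ℕ) : iterB (n + 1) = ⁅iterA n, iterB n⁆ := iterB_succ n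

lemma iterA_ne_one (n : ℕ) : iterA n ≠ 1 := by
  intro h
  have h1 : phi^[n] (of 0) = phi^[n] 1 := by rw [iterate_map_one]; exact h
  exact FreeGroup.of_ne_one _ (phi_injective.iterate n h1)

lemma iter_mem_derivedSeries (n : ℕ) :
    iterA n ∈ derivedSeries F2 n ∧ iterB n ∈ derivedSeries F2 n := by
  induction n with
  | zero => simp
  | succ n ih =>
    have hB : iterB (n + 1) ∈ derivedSeries F2 (n + 1) := by
      rw [iterB_succ_eq_commutator]
      exact Subgroup.commutator_mem_commutator ih.1 ih.2
    refine ⟨?_, hB⟩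
    have h := (derivedSeries_normal F2 (n + 1)).conj_mem _ hB (iterB n)⁻¹
    convert h using 1
    rw [iterA_succ, iterB_succ]
    group

/-- A depth in the lower central series reached by the `n`-th iterate of `phi`. -/
def depth : ℕ → ℕ
  | 0 => 1
  | 1 => 2
  | n + 2 => 2 * depth (n + 1) + depth n

lemma one_le_depth : ∀ n, 1 ≤ depth n
  | 0 => le_rfl
  | 1 => by simp [depth]
  | n + 2 => by have := one_le_depth n; simp only [depth]; omega

/-- The two elements at each stage are conjugate by an element of the previous stage, so that
their quotient, and hence their commutator, lies deeper than expected. -/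
lemma iter_mem_gamma : ∀ n, iterA n ∈ gamma (depth n) ∧ iterB n ∈ gamma (depth n)
  | 0 => by simp [gamma, depth]
  | 1 => by
    have h := iter_mem_derivedSeries 1
    exact h
  | n + 2 => by
    obtain ⟨hA0, hB0⟩ := iter_mem_gamma n
    obtain ⟨hA1, hB1⟩ := iter_mem_gamma (n + 1)
    have hquot : iterA (n + 1) * (iterB (n + 1))⁻¹ ∈ gamma (depth n + depth (n + 1)) := by
      have h := commutator_gamma_le (one_le_depth n) (one_le_depth (n + 1))
        (Subgroup.commutator_mem_commutator (inv_mem hB0) hB1)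
      convert h using 1
      rw [commutatorElement_def, iterA_succ, iterB_succ]
      group
    have hB : iterB (n + 2) ∈ gamma (depth (n + 2)) := by
      have h := commutator_gamma_le (by have := one_le_depth n; omega) (one_le_depth (n + 1))
        (Subgroup.commutator_mem_commutator hquot hB1)
      have hd : depth (n + 2) = depth n + depth (n + 1) + depth (n + 1) := by
        simp only [depth]; ring
      rw [hd]
      convert h using 1
      rw [commutatorElement_def, iterB_succ (n + 1)]
      group
    refine ⟨?_, hB⟩
    have h := (gamma_normal (depth (n + 2))).conj_mem _ hB (iterB (n + 1))⁻¹
    convert h using 1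
    rw [iterA_succ (n + 1), iterB_succ (n + 1)]
    group

/-- The larger root of `X² - 3X - 2`, which bounds the growth rate of the lengths of the iterates. -/
noncomputable def growth : ℝ := (3 + √17) / 2

lemma growth_sq : growth ^ 2 = 3 * growth + 2 := by
  have h : √17 ^ 2 = 17 := Real.sq_sqrt (by norm_num)
  unfold growth
  nlinarith

lemma growth_bounds : 3.56155 ≤ growth ∧ growth ≤ 3.561553 := by
  unfold growth
  constructor
  · have : (4.1231 : ℝ) ≤ √17 := Real.le_sqrt_of_sq_le (by norm_num)
    linarith
  · have : √17 ≤ 4.123106 := Real.sqrt_le_iff.2 (by norm_num)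
    linarith

lemma norm_mul_le_real (x y : F2) : ((x * y).norm : ℝ) ≤ x.norm + y.norm := by
  exact_mod_cast FreeGroup.norm_mul_le x y

/-- The length of the product of the two elements grows together with their lengths, and an
adjacent occurrence of this product in the next stage is responsible for the cancellation. -/
lemma norm_iter_le (n : ℕ) :
    ((iterA n).norm : ℝ) ≤ 2 * growth ^ n ∧ ((iterB n).norm : ℝ) ≤ 2 * growth ^ n ∧
      ((iterA n * iterB n).norm : ℝ) ≤ 2 * (growth - 2) * growth ^ n := by
  have hg := growth_bounds
  induction n with
  | zero =>
    have h := norm_mul_le_real (iterA 0) (iterB 0)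
    simp only [iterA, iterB, Function.iterate_zero, id, FreeGroup.norm_of, Nat.cast_one, pow_zero] at h ⊢
    refine ⟨by norm_num, by norm_num, by linarith⟩
  | succ n ih =>
    obtain ⟨hA, hB, hAB⟩ := ih
    have hA' : iterA (n + 1) = (iterB n)⁻¹ * (iterA n * iterB n) * (iterA n)⁻¹ := by
      rw [iterA_succ]; group
    have hB' : iterB (n + 1) = iterA n * iterB n * (iterA n)⁻¹ * (iterB n)⁻¹ := iterB_succ n
    have hAB' : iterA (n + 1) * iterB (n + 1) =
        (iterB n)⁻¹ * (iterA n * iterB n) * iterB n * (iterA n)⁻¹ * (iterB n)⁻¹ := by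
      rw [iterA_succ, iterB_succ]; group
    have e1 : 2 * growth ^ (n + 1) = 2 * (2 * growth ^ n) + 2 * (growth - 2) * growth ^ n := by
      ring
    have e2 : 2 * (growth - 2) * growth ^ (n + 1) =
        4 * (2 * growth ^ n) + 2 * (growth - 2) * growth ^ n := by
      linear_combination 2 * growth ^ n * growth_sq
    refine ⟨?_, ?_, ?_⟩
    · rw [hA', e1]
      have h1 := norm_mul_le_real ((iterB n)⁻¹ * (iterA n * iterB n)) (iterA n)⁻¹
      have h2 := norm_mul_le_real (iterB n)⁻¹ (iterA n * iterB n)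
      rw [FreeGroup.norm_inv_eq] at h1 h2
      linarith
    · rw [hB', e1]
      have h1 := norm_mul_le_real (iterA n * iterB n * (iterA n)⁻¹) (iterB n)⁻¹
      have h2 := norm_mul_le_real (iterA n * iterB n) (iterA n)⁻¹
      rw [FreeGroup.norm_inv_eq] at h1 h2
      linarith
    · rw [hAB', e2]
      have h1 := norm_mul_le_real
        ((iterB n)⁻¹ * (iterA n * iterB n) * iterB n * (iterA n)⁻¹) (iterB n)⁻¹
      have h2 := norm_mul_le_real ((iterB n)⁻¹ * (iterA n * iterB n) * iterB n) (iterA n)⁻¹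
      have h3 := norm_mul_le_real ((iterB n)⁻¹ * (iterA n * iterB n)) (iterB n)
      have h4 := norm_mul_le_real (iterB n)⁻¹ (iterA n * iterB n)
      rw [FreeGroup.norm_inv_eq] at h1 h2 h4
      linarith

lemma pow_le_depth_succ : ∀ n, (1 + √2) ^ n ≤ (depth (n + 1) : ℝ)
  | 0 => by simp [depth]
  | 1 => by
    have : √2 ≤ 2 := Real.sqrt_le_iff.2 (by norm_num)
    norm_num [depth]
    linarith
  | n + 2 => by
    have h0 := pow_le_depth_succ n
    have h1 := pow_le_depth_succ (n + 1)
    have h : √2 ^ 2 = 2 := Real.sq_sqrt (by norm_num)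
    have hd : (depth (n + 2 + 1) : ℝ) = 2 * depth (n + 1 + 1) + depth (n + 1) := by
      rw [show n + 2 + 1 = (n + 1) + 2 by ring, depth]; push_cast; ring
    have he : (1 + √2) ^ (n + 2) = 2 * (1 + √2) ^ (n + 1) + (1 + √2) ^ n := by
      linear_combination (1 + √2) ^ n * h
    rw [hd, he]
    linarith

lemma nontrivial_derivedSeries (n : ℕ) : ∃ w ∈ derivedSeries F2 n, w ≠ 1 :=
  ⟨_, (iter_mem_derivedSeries n).1, iterA_ne_one n⟩

lemma le_depth : ∀ n, n ≤ depth n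
  | 0 => by simp
  | 1 => by simp [depth]
  | n + 2 => by
    have := le_depth (n + 1)
    have := one_le_depth n
    simp only [depth]; omega

lemma nontrivial_gamma (n : ℕ) : ∃ w ∈ gamma n, w ≠ 1 :=
  ⟨_, gamma_antitone (le_depth n) (iter_mem_gamma n).1, iterA_ne_one n⟩

lemma alpha_depth_le (n : ℕ) : (alpha (depth n) : ℝ) ≤ 2 * growth ^ n :=
  (Nat.cast_le.2 (girth_le (iter_mem_gamma n).1 (iterA_ne_one n))).trans (norm_iter_le n).1

lemma beta_le (n : ℕ) : (beta n : ℝ) ≤ 2 * growth ^ n :=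
  (Nat.cast_le.2 (girth_le (iter_mem_derivedSeries n).1 (iterA_ne_one n))).trans
    (norm_iter_le n).1

lemma alpha_pos (n : ℕ) : 0 < alpha n := girth_pos (nontrivial_gamma n)

lemma beta_pos (n : ℕ) : 0 < beta n := girth_pos (nontrivial_derivedSeries n)

lemma alpha_mono : Monotone alpha := by
  intro m n h
  obtain ⟨w, hw, hw1, hn⟩ := exists_norm_eq_girth (nontrivial_gamma n)
  rw [alpha, alpha, ← hn]
  exact girth_le (gamma_antitone h hw) hw1

lemma alpha_mul_le {m n : ℕ} (hm : 1 ≤ m) (hn : 1 ≤ n) :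
    alpha (m * n) ≤ 3 * alpha m * alpha n :=
  girth_le_three_mul (nontrivial_gamma m) (nontrivial_gamma n) (lift_mem_gamma hm hn)

lemma beta_add_le (m n : ℕ) : beta (m + n) ≤ 3 * beta m * beta n :=
  haveI := derivedSeries_normal F2 m
  girth_le_three_mul (nontrivial_derivedSeries m) (nontrivial_derivedSeries n)
    (lift_mem_derivedSeries m n)

/-! ### Reduced walks in Cayley graphs -/

section Walks

variable {G : Type*} [Group G]

/-- The sequences `x` of letters and `v` of group elements describe an infinite walk without
backtracking in the Cayley graph of `G` with respect to the two elements `g 0` and `g 1`. -/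
structure IsReducedWalk (g : Fin 2 → G) (x : ℕ → Fin 2 × Bool) (v : ℕ → G) : Prop where
  step : ∀ n, v (n + 1) = v n * letterImage g (x n)
  ne_inv : ∀ n, x (n + 1) ≠ invLetter (x n)

/-- The word of length `k` read off a sequence of letters from position `i` on. -/
def segment (x : ℕ → Fin 2 × Bool) (i k : ℕ) : List (Fin 2 × Bool) :=
  (List.range k).map fun j => x (i + j)

@[simp] lemma length_segment (x : ℕ → Fin 2 × Bool) (i k : ℕ) : (segment x i k).length = k := by
  simp [segment]

lemma segment_succ (x : ℕ → Fin 2 × Bool) (i k : ℕ) :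
    segment x i (k + 1) = segment x i k ++ [x (i + k)] := by
  simp [segment, List.range_succ]

lemma segment_succ' (x : ℕ → Fin 2 × Bool) (i k : ℕ) :
    segment x i (k + 1) = x i :: segment x (i + 1) k := by
  simp [segment, List.range_succ_eq_map, Function.comp_def, add_assoc, add_comm 1]

/-- The edge of the Cayley graph traversed in the `n`-th step, without its direction: it is recorded
as the starting point and the label of the edge when traversed in the positive direction. -/
def edge (x : ℕ → Fin 2 × Bool) (v : ℕ → G) (n : ℕ) : G × Fin 2 :=
  (bif (x n).2 then v n else v (n + 1), (x n).1)

/-- The direction in which the edge of the `n`-th step is traversed. -/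
def edgeSign (x : ℕ → Fin 2 × Bool) (n : ℕ) : ℤ := bif (x n).2 then 1 else -1

lemma edgeSign_ne_zero (x : ℕ → Fin 2 × Bool) (n : ℕ) : edgeSign x n ≠ 0 := by
  unfold edgeSign
  cases (x n).2 <;> decide

namespace IsReducedWalk

variable {g : Fin 2 → G} {x : ℕ → Fin 2 × Bool} {v : ℕ → G}

lemma shift (h : IsReducedWalk g x v) (k : ℕ) :
    IsReducedWalk g (fun n => x (n + k)) (fun n => v (n + k)) where
  step n := by
    have := h.step (n + k)
    rwa [add_right_comm] at this
  ne_inv n := by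
    have := h.ne_inv (n + k)
    rwa [add_right_comm] at this

lemma isReduced_segment (h : IsReducedWalk g x v) (i k : ℕ) :
    FreeGroup.IsReduced (segment x i k) := by
  induction k generalizing i with
  | zero => exact .nil
  | succ k ih =>
    rw [segment_succ']
    cases k with
    | zero => exact .singleton
    | succ k =>
      have := ih (i + 1)
      rw [segment_succ'] at this ⊢
      exact FreeGroup.isReduced_cons_cons.2 ⟨ne_invLetter_iff.1 (h.ne_inv i), this⟩

lemma lift_segment (h : IsReducedWalk g x v) (i k : ℕ) :
    v i * FreeGroup.lift g (FreeGroup.mk (segment x i k)) = v (i + k) := by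
  induction k generalizing i with
  | zero => simp [segment, ← FreeGroup.one_eq_mk]
  | succ k ih =>
    rw [segment_succ', lift_mk_cons, ← mul_assoc, ← h.step, ih, add_assoc, add_comm 1]

lemma edge_eq_cases (h : IsReducedWalk g x v) {y : ℕ → Fin 2 × Bool} {u : ℕ → G}
    (h' : IsReducedWalk g y u) {i j : ℕ} (hij : edge x v i = edge y u j) :
    (x i = y j ∧ v i = u j ∧ v (i + 1) = u (j + 1)) ∨
      (y j = invLetter (x i) ∧ v i = u (j + 1) ∧ v (i + 1) = u j) := by
  have h1 := h.step i
  have h2 := h'.step j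
  obtain ⟨⟨a, b⟩, hx⟩ : ∃ l, x i = l := ⟨_, rfl⟩
  obtain ⟨⟨c, d⟩, hy⟩ : ∃ l, y j = l := ⟨_, rfl⟩
  simp only [edge, hx, hy, Prod.mk.injEq] at hij
  obtain ⟨h3, rfl⟩ := hij
  rw [hx] at h1
  rw [hy] at h2
  rw [hx, hy]
  cases b <;> cases d <;> simp_all [letterImage, invLetter]
  exact eq_mul_of_mul_inv_eq h3

lemma edge_eq_of_eq (h : IsReducedWalk g x v) {y : ℕ → Fin 2 × Bool} {u : ℕ → G}
    (h' : IsReducedWalk g y u) {i j : ℕ} (hx : x i = y j) (hv : v i = u j) :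
    edge x v i = edge y u j := by
  simp [edge, h.step, h'.step, hx, hv]

lemma edge_eq_of_eq_inv (h : IsReducedWalk g x v) {y : ℕ → Fin 2 × Bool} {u : ℕ → G}
    (h' : IsReducedWalk g y u) {i j : ℕ} (hx : x i = invLetter (y j)) (hv : v i = u (j + 1)) :
    edge x v i = edge y u j := by
  have h1 := h.step i
  have h2 := h'.step j
  rw [hx, letterImage_invLetter, hv, h2] at h1
  rcases hy : y j with ⟨c, _ | _⟩ <;> simp_all [edge, invLetter]

end IsReducedWalk

/-! ### Signed counts of edges -/

open Classical in
/-- Walking along an edge with label `s`, keeping count of the signed number of traversals of a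
fixed edge `e`. -/
noncomputable def countPerm (g : Fin 2 → G) (e : G × Fin 2) (s : Fin 2) : Equiv.Perm (G × ℤ) where
  toFun p := (p.1 * g s, p.2 + if (p.1, s) = e then 1 else 0)
  invFun p := (p.1 * (g s)⁻¹, p.2 - if (p.1 * (g s)⁻¹, s) = e then 1 else 0)
  left_inv p := by simp
  right_inv p := by simp

/-- The action of the free group by walking in the Cayley graph of `G`, keeping count of the signed
number of traversals of a fixed edge `e`. Words act from the right. -/
noncomputable def countHom (g : Fin 2 → G) (e : G × Fin 2) : F2 →* (Equiv.Perm (G × ℤ))ᵐᵒᵖ :=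
  FreeGroup.lift fun s => MulOpposite.op (countPerm g e s)

open Classical in
lemma IsReducedWalk.countHom_segment {g : Fin 2 → G} {x : ℕ → Fin 2 × Bool} {v : ℕ → G}
    (h : IsReducedWalk g x v) (e : G × Fin 2) (i k : ℕ) (n : ℤ) :
    (countHom g e (FreeGroup.mk (segment x i k))).unop (v i, n) =
      (v (i + k), n + ∑ j ∈ Finset.range k,
        if edge x v (i + j) = e then edgeSign x (i + j) else 0) := by
  induction k generalizing i n with
  | zero => simp [segment, ← FreeGroup.one_eq_mk]
  | succ k ih =>
    have hstep : (letterImage (fun s => MulOpposite.op (countPerm g e s)) (x i)).unop (v i, n) =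
        (v (i + 1), n + if edge x v i = e then edgeSign x i else 0) := by
      have h1 := h.step i
      rcases hx : x i with ⟨a, _ | _⟩ <;> rw [hx] at h1
      · simp [letterImage, edge, edgeSign, hx, countPerm, h1, Equiv.Perm.inv_def, Equiv.symm]
        split_ifs <;> ring
      · simp [letterImage, edge, edgeSign, hx, countPerm, h1]
    rw [segment_succ', countHom, lift_mk_cons, MulOpposite.unop_mul, Equiv.Perm.mul_apply, hstep,
      ← countHom, ih, Finset.sum_range_succ']
    refine Prod.ext (by rw [add_assoc, add_comm 1]) ?_
    simp only [add_zero, add_assoc, add_comm 1]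
    ring

lemma exists_countHom_apply (g : Fin 2 → G) (e : G × Fin 2) (w : F2) :
    ∃ c : G → ℤ, ∀ p, (countHom g e w).unop p = (p.1 * FreeGroup.lift g w, p.2 + c p.1) := by
  induction w using FreeGroup.induction_on with
  | C1 => exact ⟨0, fun p => by simp⟩
  | of s =>
    refine ⟨fun u => (countPerm g e s (u, 0)).2, fun p => ?_⟩
    rw [countHom, FreeGroup.lift_apply_of, FreeGroup.lift_apply_of]
    simp [countPerm]
  | inv_of s _ =>
    refine ⟨fun u => ((countPerm g e s).symm (u, 0)).2, fun p => ?_⟩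
    rw [map_inv, countHom, FreeGroup.lift_apply_of, map_inv, FreeGroup.lift_apply_of]
    simp [countPerm, Equiv.Perm.inv_def, Equiv.symm, sub_eq_add_neg]
  | mul w₁ w₂ h₁ h₂ =>
    obtain ⟨c₁, h₁⟩ := h₁
    obtain ⟨c₂, h₂⟩ := h₂
    refine ⟨fun u => c₁ u + c₂ (u * FreeGroup.lift g w₁), fun p => ?_⟩
    simp [h₁, h₂, mul_assoc, add_assoc]

/-- Elements of `K` act through closed walks, so they act by translations of the count depending on
the starting point only, and these commute. -/
lemma countHom_eq_one {g : Fin 2 → G} {K : Subgroup F2} (hK : ∀ w ∈ K, FreeGroup.lift g w = 1)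
    (e : G × Fin 2) {w : F2} (hw : w ∈ ⁅K, K⁆) : countHom g e w = 1 := by
  have hle : ⁅K, K⁆ ≤ (countHom g e).ker := by
    rw [Subgroup.commutator_le]
    intro u hu w hw
    obtain ⟨c₁, h₁⟩ := exists_countHom_apply g e u
    obtain ⟨c₂, h₂⟩ := exists_countHom_apply g e w
    rw [MonoidHom.mem_ker, map_commutatorElement, commutatorElement_eq_one_iff_mul_comm]
    apply MulOpposite.unop_injective
    ext1 p
    simp [h₁, h₂, hK u hu, hK w hw, add_right_comm]
  exact hle hw

end Walks

/-! ### Closed walks that are homologically trivial -/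

section ClosedWalks

variable {G : Type*} [Group G] {g : Fin 2 → G} {x : ℕ → Fin 2 × Bool} {v : ℕ → G}

lemma le_length_add_length {L : ℕ} (hL : ∀ w : F2, w ≠ 1 → FreeGroup.lift g w = 1 → L ≤ w.norm)
    {P Q : List (Fin 2 × Bool)} (hP : FreeGroup.IsReduced P) (hQ : FreeGroup.IsReduced Q)
    (hPQ : P.head? ≠ Q.head?) (h : FreeGroup.lift g (mk P) = FreeGroup.lift g (mk Q)) :
    L ≤ P.length + Q.length := by
  have hne : (mk P : F2) * (mk Q)⁻¹ ≠ 1 := by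
    rw [Ne, mul_inv_eq_one]
    intro h'
    have h2 := FreeGroup.reduce.sound h'
    rw [hP.reduce_eq, hQ.reduce_eq] at h2
    exact hPQ (by rw [h2])
  refine (hL _ hne (by rw [map_mul, map_inv, h, mul_inv_cancel])).trans ?_
  refine (FreeGroup.norm_mul_le _ _).trans ?_
  rw [FreeGroup.norm_inv_eq]
  exact add_le_add FreeGroup.norm_mk_le FreeGroup.norm_mk_le

open Classical in
/-- A walk of length `N` traversing every edge equally often in both directions traverses each of its
edges at least twice. -/
lemma two_mul_card_le {V : Type*} {x : ℕ → Fin 2 × Bool} {v : ℕ → V} {N : ℕ}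
    (hsum : ∀ e, ∑ i ∈ Finset.range N, (if edge x v i = e then edgeSign x i else 0) = 0)
    {S : Finset ℕ} (hS : S ⊆ Finset.range N) (hinj : Set.InjOn (edge x v) S) :
    2 * S.card ≤ N := by
  have h1 := Finset.mul_card_image_le_card (f := edge x v) (Finset.range N) 2 (by
    intro e he
    obtain ⟨i, hi, rfl⟩ := Finset.mem_image.1 he
    have hmem : i ∈ (Finset.range N).filter fun j => edge x v j = edge x v i := by
      simpa using hi
    by_contra hlt
    have hcard : ((Finset.range N).filter fun j => edge x v j = edge x v i).card = 1 := by
      have := Finset.card_pos.2 ⟨i, hmem⟩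
      omega
    obtain ⟨j, hj⟩ := Finset.card_eq_one.1 hcard
    have h0 := hsum (edge x v i)
    rw [← Finset.sum_filter, hj, Finset.sum_singleton] at h0
    exact edgeSign_ne_zero x j h0)
  have h2 := Finset.card_le_card (Finset.image_subset_image (f := edge x v) hS)
  rw [Finset.card_image_of_injOn hinj] at h2
  rw [Finset.card_range] at h1
  omega

namespace IsReducedWalk

lemma le_of_closed (h : IsReducedWalk g x v) {L : ℕ}
    (hL : ∀ w : F2, w ≠ 1 → FreeGroup.lift g w = 1 → L ≤ w.norm) {i k : ℕ} (hk : 0 < k)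
    (hv : v i = v (i + k)) : L ≤ k := by
  have h1 : FreeGroup.lift g (FreeGroup.mk (segment x i k)) = 1 := by
    have := h.lift_segment i k
    rwa [← hv, mul_eq_left] at this
  obtain ⟨k, rfl⟩ := Nat.exists_eq_succ_of_ne_zero hk.ne'
  have := le_length_add_length hL (h.isReduced_segment i (k + 1)) .nil
    (by simp [segment_succ']) (by rw [h1, ← FreeGroup.one_eq_mk, map_one])
  simpa using this

/-- Edges traversed within fewer steps than it takes to close up a walk are distinct. -/
lemma edge_ne_edge (h : IsReducedWalk g x v) {d : ℕ}
    (hmin : ∀ i k, 0 < k → k < d → v i ≠ v (i + k)) {i j : ℕ} (hij : i < j) (hjd : j < i + d) :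
    edge x v i ≠ edge x v j := by
  intro he
  obtain ⟨k, rfl⟩ := Nat.exists_eq_add_of_lt hij
  rcases h.edge_eq_cases h he with ⟨-, h1, -⟩ | ⟨h1, -, h2⟩
  · exact hmin i (k + 1) (by omega) (by omega) h1
  · rcases Nat.eq_zero_or_pos k with rfl | hk
    · exact h.ne_inv i h1
    · exact hmin (i + 1) k hk (by omega) (by rw [h2]; congr 1; ring)

/-- A closed path of minimal length in a reduced walk, traversed periodically, is again a reduced
walk. -/
lemma periodic (h : IsReducedWalk g x v) {d : ℕ} (hd : 0 < d)
    (hmin : ∀ i k, 0 < k → k < d → v i ≠ v (i + k)) (hvd : v 0 = v d) :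
    IsReducedWalk g (fun n => x (n % d)) (fun n => v (n % d)) := by
  have hmod : ∀ n, (n + 1) % d = n % d + 1 ∨ ((n + 1) % d = 0 ∧ n % d + 1 = d) := by
    intro n
    have := Nat.mod_lt n hd
    rw [Nat.add_mod_eq_ite]
    rcases Nat.lt_or_ge 1 d with h1 | h1
    · rw [Nat.mod_eq_of_lt h1]
      split_ifs <;> omega
    · obtain rfl : d = 1 := by omega
      right
      simp [Nat.mod_one]
  constructor
  · intro n
    rcases hmod n with h1 | ⟨h1, h2⟩
    · simp only [h1, h.step]
    · simp only [h1]
      rw [← h.step, h2, hvd]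
  · intro n
    rcases hmod n with h1 | ⟨h1, h2⟩
    · simp only [h1]
      exact h.ne_inv _
    · simp only [h1]
      rcases Nat.eq_zero_or_pos (n % d) with h3 | h3
      · rw [h3]
        exact (invLetter_ne_self _).symm
      · intro h4
        refine h.edge_ne_edge hmin h3 (by omega) (h.edge_eq_of_eq_inv h h4 ?_)
        rw [h2, hvd]

open Classical in
/-- A walk of length `N` traversing every edge equally often in both directions does not stay on the
edges of its first `d` steps, if no segment of fewer than `d` steps closes up. -/
lemma exists_edge_ne (h : IsReducedWalk g x v) {N d : ℕ} (hN : 0 < N) (hd : 0 < d)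
    (hmin : ∀ i k, 0 < k → k < d → v i ≠ v (i + k))
    (hsum : ∀ e, ∑ i ∈ Finset.range N, (if edge x v i = e then edgeSign x i else 0) = 0) :
    ∃ p < N, ∀ a < d, edge x v p ≠ edge x v a := by
  by_contra! hcon
  -- the walk keeps running around the cycle in the initial direction
  have hrun : ∀ p < N, ∃ a < d, x p = x a ∧ v p = v a := by
    intro p
    induction p with
    | zero => exact fun _ => ⟨0, hd, rfl, rfl⟩
    | succ p ih =>
      intro hp
      obtain ⟨a, ha, hxa, hva⟩ := ih (by omega)
      obtain ⟨b, hb, hab⟩ := hcon (p + 1) hp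
      rcases h.edge_eq_cases h hab with ⟨h1, h2, -⟩ | ⟨h1, h2, -⟩
      · exact ⟨b, hb, h1, h2⟩
      · exfalso
        have h3 : v (a + 1) = v (b + 1) := by rw [← h2, h.step, h.step, hxa, hva]
        have h4 : a = b := by
          rcases lt_trichotomy a b with h5 | h5 | h5
          · exact absurd (by rw [h3]; congr 1; omega) (hmin (a + 1) (b - a) (by omega) (by omega))
          · exact h5
          · exact absurd (by rw [← h3]; congr 1; omega)
              (hmin (b + 1) (a - b) (by omega) (by omega))
        apply h.ne_inv p
        rw [hxa, h4, h1, invLetter_invLetter]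
  have hsign : ∀ i ∈ Finset.range N, (if edge x v i = edge x v 0 then edgeSign x i else 0) =
      if edge x v i = edge x v 0 then edgeSign x 0 else 0 := by
    intro i hi
    split_ifs with hi0
    · obtain ⟨a, ha, hxa, hva⟩ := hrun i (Finset.mem_range.1 hi)
      have ha0 : a = 0 := by
        by_contra hne
        exact h.edge_ne_edge hmin (Nat.pos_of_ne_zero hne) (by omega)
          (hi0.symm.trans (h.edge_eq_of_eq h hxa hva))
      simp [edgeSign, hxa, ha0]
    · rfl
  have h0 := hsum (edge x v 0)
  rw [Finset.sum_congr rfl hsign, ← Finset.sum_filter, Finset.sum_const, nsmul_eq_mul,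
    mul_eq_zero] at h0
  rcases h0 with h0 | h0
  · rw [Nat.cast_eq_zero, Finset.card_eq_zero] at h0
    have : 0 ∈ (Finset.range N).filter fun i => edge x v i = edge x v 0 := by simp [hN]
    simp [h0] at this
  · exact edgeSign_ne_zero x 0 h0

/-- The part of the walk between leaving a cycle at `v p` and returning to it at `v q` forms
closed paths with both arcs of the cycle between these points. -/
lemma two_mul_le_excursion (h : IsReducedWalk g x v) {L d p q a b : ℕ} (hd : 0 < d)
    (hL : ∀ w : F2, w ≠ 1 → FreeGroup.lift g w = 1 → L ≤ w.norm)
    (hmin : ∀ i k, 0 < k → k < d → v i ≠ v (i + k)) (hvd : v 0 = v d)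
    (hp : ∀ c < d, edge x v p ≠ edge x v c) (hpq : p < q) (ha : a < d) (hb : b < d)
    (hpa : v p = v a) (hqb : v q = v b) : 2 * L ≤ 2 * (q - p) + d := by
  have hC := h.periodic hd hmin hvd
  set X : ℕ → Fin 2 × Bool := fun n => x (n % d) with hX
  set V : ℕ → G := fun n => v (n % d) with hV
  have hne : ∀ n, edge x v p ≠ edge X V n := by
    intro n he
    refine hp (n % d) (Nat.mod_lt n hd) (he.trans ?_)
    exact hC.edge_eq_of_eq h rfl rfl
  obtain ⟨k, rfl⟩ := Nat.exists_eq_add_of_lt hpq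
  set t := (d + b - a) % d
  have ht : t < d := Nat.mod_lt _ hd
  have hVa : V a = v a := by simp [hV, Nat.mod_eq_of_lt ha]
  have hVt : V (a + t) = v b := by
    have : (a + t) % d = b := by
      rw [Nat.add_mod_mod, show a + (d + b - a) = d + b by omega, Nat.add_mod_left,
        Nat.mod_eq_of_lt hb]
    simp only [hV, this]
  have hVd : V (a + t + (d - t)) = v a := by
    have : (a + t + (d - t)) % d = a := by
      rw [show a + t + (d - t) = d + a by omega, Nat.add_mod_left, Nat.mod_eq_of_lt ha]
    simp only [hV, this]
  have hexc := h.lift_segment p (k + 1)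
  rw [hpa, ← add_assoc, hqb] at hexc
  have hhead : (segment x p (k + 1)).head? = some (x p) := by simp [segment_succ']
  have h1 : L ≤ (k + 1) + t := by
    have := le_length_add_length hL (h.isReduced_segment p (k + 1)) (hC.isReduced_segment a t) ?_ ?_
    · simpa using this
    · rw [hhead]
      cases t with
      | zero => simp [segment]
      | succ t =>
        rw [segment_succ', List.head?_cons]
        intro hx
        exact hne a (h.edge_eq_of_eq hC (Option.some.inj hx) (by rw [hVa, hpa]))
    · have h2 := hC.lift_segment a t
      rw [hVa, hVt] at h2
      exact mul_left_cancel (hexc.trans h2.symm)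
  have h2 : L ≤ (k + 1) + (d - t) := by
    have := le_length_add_length hL (h.isReduced_segment p (k + 1))
      (Q := FreeGroup.invRev (segment X (a + t) (d - t))) ?_ ?_ ?_
    · simpa using this
    · rw [FreeGroup.isReduced_iff_reduce_eq, FreeGroup.reduce_invRev,
        (hC.isReduced_segment _ _).reduce_eq]
    · obtain ⟨r, hr⟩ := Nat.exists_eq_add_of_lt ht
      rw [show d - t = r + 1 by omega] at hVd ⊢
      rw [hhead, segment_succ]
      intro hx
      refine hne (a + t + r) (h.edge_eq_of_eq_inv hC ?_ (by rw [add_assoc _ r, hVd, hpa]))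
      simpa [FreeGroup.invRev, invLetter] using hx
    · have h3 := hC.lift_segment (a + t) (d - t)
      rw [hVt, hVd] at h3
      rw [← FreeGroup.inv_mk, map_inv, eq_inv_iff_mul_eq_one]
      rw [← hexc, mul_assoc, mul_eq_left] at h3
      exact h3
  omega

open Classical in
/-- The underlying graph of the walk contains, besides a shortest cycle of length `d`, either at
least `d` further edges, or a further path whose length is at least `L - d / 2`. Every edge is
traversed twice. -/
lemma three_mul_le_of_minimal_start (h : IsReducedWalk g x v) {L N d : ℕ} (hN : 0 < N)
    (hL : ∀ w : F2, w ≠ 1 → FreeGroup.lift g w = 1 → L ≤ w.norm) (hvN : v 0 = v N)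
    (hsum : ∀ e, ∑ i ∈ Finset.range N, (if edge x v i = e then edgeSign x i else 0) = 0)
    (hd : 0 < d) (hmin : ∀ i k, 0 < k → k < d → v i ≠ v (i + k)) (hvd : v 0 = v d) :
    3 * L ≤ N := by
  have hLd : L ≤ d := h.le_of_closed hL hd (by rw [hvd, zero_add])
  -- the walk leaves the cycle at `v p` and first returns to it at `v q`
  have hex := h.exists_edge_ne hN hd hmin hsum
  set p := Nat.find hex with hpdef
  obtain ⟨hpN, hp⟩ : p < N ∧ ∀ a < d, edge x v p ≠ edge x v a := Nat.find_spec hex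
  have hpmin : ∀ p' < p, ∃ a < d, edge x v p' = edge x v a := by
    intro p' hp'
    have := Nat.find_min hex hp'
    push Not at this
    exact this (by omega)
  have hdp : d ≤ p := by
    by_contra hlt
    exact hp p (by omega) rfl
  have hend : ∀ j c, c < d → edge x v j = edge x v c →
      (∃ a < d, v j = v a) ∧ ∃ a < d, v (j + 1) = v a := by
    intro j c hc he
    have hc' : ∃ a < d, v (c + 1) = v a := by
      rcases Nat.lt_or_ge (c + 1) d with h1 | h1
      · exact ⟨c + 1, h1, rfl⟩
      · exact ⟨0, hd, by rw [hvd]; congr 1; omega⟩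
    obtain ⟨a, ha, hca⟩ := hc'
    rcases h.edge_eq_cases h he with ⟨-, h1, h2⟩ | ⟨-, h1, h2⟩
    · exact ⟨⟨c, hc, h1⟩, a, ha, h2.trans hca⟩
    · exact ⟨⟨a, ha, h1.trans hca⟩, c, hc, h2⟩
  obtain ⟨a, ha, hpa⟩ : ∃ a < d, v p = v a := by
    obtain ⟨c, hc, he⟩ := hpmin (p - 1) (by omega)
    have := (hend _ c hc he).2
    rwa [Nat.sub_add_cancel (by omega)] at this
  have hret : ∃ q, p < q ∧ ∃ b < d, v q = v b := ⟨N, hpN, 0, hd, hvN.symm⟩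
  set q := Nat.find hret with hqdef
  obtain ⟨hpq, b, hb, hqb⟩ : p < q ∧ ∃ b < d, v q = v b := Nat.find_spec hret
  have hqN : q ≤ N := Nat.find_min' hret ⟨hpN, 0, hd, hvN.symm⟩
  have hout : ∀ j, p ≤ j → j < q → ∀ c < d, edge x v j ≠ edge x v c := by
    intro j hpj hjq c hc he
    rcases hpj.eq_or_lt with rfl | hlt
    · exact hp c hc he
    · exact Nat.find_min hret hjq ⟨hlt, (hend j c hc he).1⟩
  have hexc := h.two_mul_le_excursion hd hL hmin hvd hp hpq ha hb hpa hqb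
  set m := min (q - p) d
  have hmd : m ≤ d := min_le_right _ _
  have hmq : m ≤ q - p := min_le_left _ _
  have hcard := two_mul_card_le hsum (S := Finset.range d ∪ Finset.Ico p (p + m)) ?_ ?_
  · rw [Finset.card_union_of_disjoint, Finset.card_range, Nat.card_Ico] at hcard
    · rcases min_choice (q - p) d with h1 | h1 <;> omega
    · rw [Finset.disjoint_left]
      intro i hi hi'
      rw [Finset.mem_range] at hi
      rw [Finset.mem_Ico] at hi'
      omega
  · intro i hi
    simp only [Finset.mem_union, Finset.mem_range, Finset.mem_Ico] at hi ⊢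
    omega
  · have hlt : ∀ i ∈ Finset.range d ∪ Finset.Ico p (p + m),
        ∀ j ∈ Finset.range d ∪ Finset.Ico p (p + m), i < j → edge x v i ≠ edge x v j := by
      intro i hi j hj hij
      simp only [Finset.mem_union, Finset.mem_range, Finset.mem_Ico] at hi hj
      rcases Nat.lt_or_ge j (i + d) with h1 | h1
      · exact h.edge_ne_edge hmin hij h1
      · exact (hout j (by omega) (by omega) i (by omega)).symm
    intro i hi j hj he
    by_contra hne
    rcases Nat.lt_or_gt_of_ne hne with h1 | h1
    · exact hlt i hi j hj h1 he
    · exact hlt j hj i hi h1 he.symm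

end IsReducedWalk

lemma sum_range_shift {f : ℕ → ℤ} {N : ℕ} (hf : ∀ n, f (n + N) = f n) (k : ℕ) :
    ∑ i ∈ Finset.range N, f (i + k) = ∑ i ∈ Finset.range N, f i := by
  induction k with
  | zero => rfl
  | succ k ih =>
    rw [← ih]
    have h1 := Finset.sum_range_succ (fun i => f (i + k)) N
    have h2 := Finset.sum_range_succ' (fun i => f (i + k)) N
    rw [h1, add_comm N k, hf, zero_add] at h2
    have h3 := add_right_cancel h2
    rw [h3]
    exact Finset.sum_congr rfl fun i _ => by congr 1; ring

open Classical in
/-- A periodic reduced walk that traverses every edge equally often in both directions during a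
period `N` has `3 * L ≤ N` if all closed reduced walks have length at least `L`. -/
theorem IsReducedWalk.three_mul_le (h : IsReducedWalk g x v) {L N : ℕ} (hN : 0 < N)
    (hL : ∀ w : F2, w ≠ 1 → FreeGroup.lift g w = 1 → L ≤ w.norm)
    (hxN : ∀ n, x (n + N) = x n) (hvN : ∀ n, v (n + N) = v n)
    (hsum : ∀ e, ∑ i ∈ Finset.range N, (if edge x v i = e then edgeSign x i else 0) = 0) :
    3 * L ≤ N := by
  have hex : ∃ d, 0 < d ∧ ∃ i, v i = v (i + d) := ⟨N, hN, 0, (hvN 0).symm⟩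
  obtain ⟨hd, s, hs⟩ := Nat.find_spec hex
  refine (h.shift s).three_mul_le_of_minimal_start hN hL ?_ ?_ hd ?_ ?_
  · simp only [zero_add]
    rw [add_comm, hvN]
  · intro e
    have h1 : ∀ i, edge (fun n => x (n + s)) (fun n => v (n + s)) i = edge x v (i + s) := by
      intro i
      simp [edge, add_right_comm]
    have h2 : ∀ n, edge x v (n + N) = edge x v n := by
      intro n
      simp [edge, hxN, hvN, add_right_comm n N 1]
    have h3 : ∀ n, edgeSign x (n + N) = edgeSign x n := by
      intro n
      simp [edgeSign, hxN]
    refine (Finset.sum_congr rfl fun i _ => ?_).trans ((sum_range_shift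
      (f := fun i => if edge x v i = e then edgeSign x i else 0) (N := N) ?_ s).trans (hsum e))
    · simp only [h1]
      rfl
    · intro n
      simp only [h2, h3]
  · intro i k hk hkd he
    refine Nat.find_min hex hkd ⟨hk, i + s, ?_⟩
    rw [he]
    congr 1
    ring
  · simp only [zero_add]
    rw [hs, add_comm]

end ClosedWalks

/-! ### The lower bound for the derived series -/

open Classical in
/-- Reading a cyclically reduced word of the commutator subgroup of `H` periodically gives a
closed walk in the Cayley graph of the quotient by `H`. -/
theorem three_mul_le_norm_of_mem_commutator {H : Subgroup F2} [H.Normal] {L : ℕ}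
    (hL : ∀ w ∈ H, w ≠ 1 → L ≤ w.norm) {w : F2} (hw : w ∈ ⁅H, H⁆) (hw1 : w ≠ 1) :
    3 * L ≤ w.norm := by
  obtain ⟨U, hU, hU0, hUH, hUw⟩ := exists_isCyclicallyReduced hw hw1
  refine le_trans ?_ hUw
  have hN : 0 < U.length := List.length_pos_iff.2 hU0
  let g : Fin 2 → F2 ⧸ H := fun i => QuotientGroup.mk' H (of i)
  have hlift : FreeGroup.lift g = QuotientGroup.mk' H := by
    ext i
    simp [g]
  have hker : ∀ w : F2, FreeGroup.lift g w = 1 ↔ w ∈ H := by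
    intro w
    rw [hlift, ← MonoidHom.mem_ker, QuotientGroup.ker_mk']
  let x : ℕ → Fin 2 × Bool := fun n => U[n % U.length]'(Nat.mod_lt n hN)
  let v : ℕ → F2 ⧸ H := fun n => FreeGroup.lift g (mk (segment x 0 n))
  have hxN : ∀ n, x (n + U.length) = x n := fun n => by simp [x]
  have hwalk : IsReducedWalk g x v := by
    constructor
    · intro n
      simp only [v]
      rw [segment_succ, ← FreeGroup.mul_mk, map_mul, lift_mk_cons, ← FreeGroup.one_eq_mk, map_one,
        mul_one, zero_add]
    · intro n
      have hlt := Nat.mod_lt n hN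
      rw [ne_invLetter_iff]
      rcases Nat.lt_or_ge (n % U.length + 1) U.length with h1 | h1
      · have h2 : (n + 1) % U.length = n % U.length + 1 := by
          rw [← Nat.mod_add_mod, Nat.mod_eq_of_lt h1]
        have h3 := List.isChain_iff_getElem.1 hU.isReduced (n % U.length) h1
        simpa only [x, h2] using h3
      · have h2 : (n + 1) % U.length = 0 := by
          rw [← Nat.mod_add_mod, show n % U.length + 1 = U.length by omega, Nat.mod_self]
        have h3 := hU.2 _ (List.getLast_mem_getLast? hU0) _ (List.head_mem_head? hU0)
        rw [List.getLast_eq_getElem, List.head_eq_getElem] at h3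
        simpa only [x, h2, show n % U.length = U.length - 1 by omega] using h3
  have hseg : segment x 0 U.length = U := by
    apply List.ext_getElem
    · simp
    · intro i h1 h2
      simp [segment, x, Nat.mod_eq_of_lt h2]
  have hv0 : v 0 = 1 := by simp [v, segment]
  have hvN' : v U.length = 1 := by
    simp only [v, hseg]
    exact (hker _).2 (Subgroup.commutator_le_left H H hUH)
  have hvN : ∀ n, v (n + U.length) = v n := by
    intro n
    induction n with
    | zero => rw [zero_add, hv0, hvN']
    | succ n ih => rw [add_right_comm, hwalk.step, hwalk.step, ih, hxN]
  refine hwalk.three_mul_le hN (fun w hw1 hw => hL w ((hker w).1 hw) hw1) hxN hvN fun e => ?_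
  have h1 := hwalk.countHom_segment e 0 U.length 0
  rw [hseg, countHom_eq_one (fun w hw => (hker w).2 hw) e hUH] at h1
  have h2 := congrArg Prod.snd h1
  simp only [MulOpposite.unop_one, Equiv.Perm.one_apply, zero_add] at h2
  convert h2.symm

lemma pow_three_le_beta (n : ℕ) : 3 ^ n ≤ beta n := by
  induction n with
  | zero => exact beta_pos 0
  | succ n ih =>
    have hnormal := derivedSeries_normal F2 n
    obtain ⟨w, hw, hw1, hwn⟩ := exists_norm_eq_girth (nontrivial_derivedSeries (n + 1))
    rw [derivedSeries_succ] at hw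
    have h := three_mul_le_norm_of_mem_commutator (fun u hu hu1 => girth_le hu hu1) hw hw1
    rw [hwn] at h
    calc 3 ^ (n + 1) = 3 * 3 ^ n := by ring
      _ ≤ 3 * beta n := Nat.mul_le_mul_left 3 ih
      _ ≤ beta (n + 1) := h

/-! ### The limits -/

lemma tendsto_sub_div_add_one {h : ℕ → ℝ} {l : ℝ} (c : ℝ)
    (hl : Tendsto (fun n => h n / n) atTop (𝓝 l)) :
    Tendsto (fun n : ℕ => (h n - c) / (n + 1)) atTop (𝓝 l) := by
  have h1 : Tendsto (fun n : ℕ => (n : ℝ) / (n + 1)) atTop (𝓝 1) :=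
    tendsto_natCast_div_add_atTop 1
  have h2 : Tendsto (fun n : ℕ => c * (1 / ((n : ℝ) + 1))) atTop (𝓝 (c * 0)) :=
    tendsto_one_div_add_atTop_nhds_zero_nat.const_mul c
  have h3 := (hl.mul h1).sub h2
  rw [mul_one, mul_zero, sub_zero] at h3
  refine h3.congr' ?_
  filter_upwards [eventually_ge_atTop 1] with n hn
  have : (n : ℝ) ≠ 0 := by positivity
  field_simp

lemma tendsto_succ_sub_div {h : ℕ → ℝ} {l : ℝ} (c : ℝ)
    (hl : Tendsto (fun n => h n / n) atTop (𝓝 l)) :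
    Tendsto (fun n : ℕ => (h (n + 1) - c) / n) atTop (𝓝 l) := by
  have h1 : Tendsto (fun n : ℕ => 1 + (n : ℝ)⁻¹) atTop (𝓝 (1 + 0)) :=
    tendsto_const_nhds.add tendsto_inv_atTop_nhds_zero_nat
  have h2 : Tendsto (fun n : ℕ => c * (n : ℝ)⁻¹) atTop (𝓝 (c * 0)) :=
    tendsto_inv_atTop_nhds_zero_nat.const_mul c
  have h3 := (((tendsto_add_atTop_iff_nat 1).2 hl).mul h1).sub h2
  rw [add_zero, mul_one, mul_zero, sub_zero] at h3
  refine h3.congr' ?_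
  filter_upwards [eventually_ge_atTop 1] with n hn
  have : (n : ℝ) ≠ 0 := by positivity
  push_cast
  field_simp

/-- Fekete's lemma, up to an additive constant, for monotone functions that are subadditive with
respect to multiplication: it is applied along the powers of two. -/
lemma exists_tendsto_div_logb {f : ℕ → ℝ} (c : ℝ) (hmono : Monotone f) (h0 : ∀ n, 0 ≤ f n)
    (hc : 0 ≤ c) (hf : ∀ m n, 1 ≤ m → 1 ≤ n → f (m * n) ≤ f m + f n + c) :
    ∃ a, Tendsto (fun n : ℕ => f n / Real.logb 2 n) atTop (𝓝 a) := by
  have hsub : Subadditive fun t : ℕ => f (2 ^ t) + c := by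
    intro s t
    have := hf (2 ^ s) (2 ^ t) Nat.one_le_two_pow Nat.one_le_two_pow
    rw [← pow_add] at this
    linarith
  have hlim := hsub.tendsto_lim ⟨0, by
    rintro _ ⟨t, rfl⟩
    exact div_nonneg (add_nonneg (h0 _) hc) (Nat.cast_nonneg _)⟩
  have hlog : Tendsto (Nat.log 2) atTop atTop :=
    tendsto_atTop_atTop.2 fun b => ⟨2 ^ b, fun n hn => Nat.le_log_of_pow_le (by norm_num) hn⟩
  refine ⟨hsub.lim, tendsto_of_tendsto_of_tendsto_of_le_of_le'
    ((tendsto_sub_div_add_one c hlim).comp hlog) ((tendsto_succ_sub_div c hlim).comp hlog) ?_ ?_⟩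
  all_goals
    filter_upwards [eventually_ge_atTop 2] with n hn
    have hn0 : (0 : ℝ) < n := by positivity
    have ht : (1 : ℝ) ≤ Nat.log 2 n := by exact_mod_cast Nat.log_pos (by norm_num) hn
    have hle : 2 ^ Nat.log 2 n ≤ n := Nat.pow_log_le_self 2 (by omega)
    have hlt : n < 2 ^ (Nat.log 2 n + 1) := Nat.lt_pow_succ_log_self (by norm_num) n
    have hle' : (Nat.log 2 n : ℝ) ≤ Real.logb 2 n := by
      rw [Real.le_logb_iff_rpow_le (by norm_num) hn0, Real.rpow_natCast]
      exact_mod_cast hle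
    have hlt' : Real.logb 2 n ≤ (Nat.log 2 n : ℝ) + 1 := by
      rw [Real.logb_le_iff_le_rpow (by norm_num) hn0, ← Nat.cast_add_one, Real.rpow_natCast]
      exact_mod_cast hlt.le
  · simp only [Function.comp_apply, add_sub_cancel_right]
    exact div_le_div₀ (h0 _) (hmono hle) (by linarith) hlt'
  · simp only [Function.comp_apply, add_sub_cancel_right]
    exact div_le_div₀ (h0 _) (hmono hlt.le) (by linarith) hle'

lemma logb_growth : Real.logb 2 growth = betaBound := by
  rw [growth, betaBound, Real.logb_div (by positivity) (by norm_num), Real.logb_self_eq_one]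
  norm_num

lemma alphaBound_eq : alphaBound = betaBound / Real.logb 2 (1 + √2) := rfl

lemma logb_le_of_le_growth_pow {x : ℝ} (hx : 0 < x) {n : ℕ} (h : x ≤ 2 * growth ^ n) :
    Real.logb 2 x ≤ betaBound * n + 1 := by
  have hg : 0 < growth := by have := growth_bounds; linarith
  calc Real.logb 2 x ≤ Real.logb 2 (2 * growth ^ n) :=
        Real.logb_le_logb_of_le (by norm_num) hx h
    _ = betaBound * n + 1 := by
        rw [Real.logb_mul (by norm_num) (by positivity), Real.logb_pow, logb_growth,
          Real.logb_self_eq_one (by norm_num)]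
        ring

lemma logb_natCast_nonneg (n : ℕ) : 0 ≤ Real.logb 2 (n : ℝ) := by
  rcases Nat.eq_zero_or_pos n with rfl | hn
  · simp
  · exact Real.logb_nonneg (by norm_num) (by exact_mod_cast hn)

lemma logb_le_of_le_three_mul {k m n : ℕ} (hk : 0 < k) (hm : 0 < m) (hn : 0 < n)
    (h : k ≤ 3 * m * n) :
    Real.logb 2 (k : ℝ) ≤ Real.logb 2 m + Real.logb 2 n + Real.logb 2 3 := by
  have h' : (k : ℝ) ≤ 3 * m * n := by exact_mod_cast h
  refine (Real.logb_le_logb_of_le (by norm_num) (by positivity) h').trans_eq ?_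
  rw [Real.logb_mul (by positivity) (by positivity), Real.logb_mul (by norm_num) (by positivity)]
  ring

lemma exists_tendsto_alpha :
    ∃ a : ℝ, Tendsto (fun n : ℕ => Real.logb 2 (alpha n : ℝ) / Real.logb 2 (n : ℝ)) atTop (𝓝 a) :=
  exists_tendsto_div_logb (f := fun n => Real.logb 2 (alpha n : ℝ)) (Real.logb 2 3)
    (fun m n h => Real.logb_le_logb_of_le (by norm_num) (by exact_mod_cast alpha_pos m)
      (by exact_mod_cast alpha_mono h))
    (fun n => logb_natCast_nonneg _) (Real.logb_nonneg (by norm_num) (by norm_num))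
    fun m n hm hn => logb_le_of_le_three_mul (alpha_pos _) (alpha_pos _) (alpha_pos _)
      (alpha_mul_le hm hn)

lemma alpha_limit_le {a : ℝ}
    (ha : Tendsto (fun n : ℕ => Real.logb 2 (alpha n : ℝ) / Real.logb 2 (n : ℝ)) atTop (𝓝 a)) :
    a ≤ alphaBound := by
  have hd : Tendsto (fun k => depth (k + 1)) atTop atTop :=
    tendsto_atTop_mono (fun k => (Nat.le_succ k).trans (le_depth (k + 1))) tendsto_id
  have hμ : 0 < Real.logb 2 (1 + √2) := by
    have : 0 < √2 := by positivity
    exact Real.logb_pos (by norm_num) (by linarith)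
  have h2 : Tendsto (fun k : ℕ => ((betaBound * (k + 1 : ℕ) - (-1)) / k) / Real.logb 2 (1 + √2))
      atTop (𝓝 (betaBound / Real.logb 2 (1 + √2))) := by
    refine (tendsto_succ_sub_div (h := fun k => betaBound * k) (-1) ?_).div_const _
    refine tendsto_const_nhds.congr' ?_
    filter_upwards [eventually_ge_atTop 1] with n hn
    have : (n : ℝ) ≠ 0 := by positivity
    field_simp
  refine le_of_tendsto_of_tendsto (ha.comp hd) h2 ?_
  filter_upwards [eventually_ge_atTop 1] with k hk
  have hk' : (0 : ℝ) < k := by exact_mod_cast hk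
  have hden : k * Real.logb 2 (1 + √2) ≤ Real.logb 2 (depth (k + 1)) := by
    rw [← Real.logb_pow]
    exact Real.logb_le_logb_of_le (by norm_num) (by positivity) (pow_le_depth_succ k)
  have hnum := logb_le_of_le_growth_pow (by exact_mod_cast alpha_pos _) (alpha_depth_le (k + 1))
  rw [div_div, Function.comp_apply]
  refine div_le_div₀ ((logb_natCast_nonneg _).trans (hnum.trans_eq ?_)) (hnum.trans_eq ?_)
    (by positivity) hden <;> ring

lemma alpha_preceq {a ε : ℝ} (hε : 0 < ε)
    (ha : Tendsto (fun n : ℕ => Real.logb 2 (alpha n : ℝ) / Real.logb 2 (n : ℝ)) atTop (𝓝 a))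
    (haν : a ≤ alphaBound) (hν : 0 ≤ alphaBound) :
    Preceq (fun n : ℕ => (alpha n : ℝ)) (fun n : ℕ => (n : ℝ) ^ (alphaBound + ε)) := by
  obtain ⟨N, hN⟩ := eventually_atTop.1
    ((ha.eventually_lt_const (by linarith : a < alphaBound + ε)).and (eventually_ge_atTop 2))
  have hC : (1 : ℝ) ≤ alpha N := by exact_mod_cast alpha_pos N
  refine ⟨alpha N, fun n hn => ?_⟩
  have hn1 : (1 : ℝ) ≤ n := by exact_mod_cast hn
  have hn0 : (0 : ℝ) < n := by linarith
  have hp : 0 ≤ alphaBound + ε := by linarith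
  have hCn : (n : ℝ) ≤ (alpha N * n : ℕ) := by
    push_cast
    exact le_mul_of_one_le_left hn0.le hC
  have hpow : (n : ℝ) ^ (alphaBound + ε) ≤ ((alpha N * n : ℕ) : ℝ) ^ (alphaBound + ε) :=
    Real.rpow_le_rpow hn0.le hCn hp
  rcases le_total n N with h | h
  · calc (alpha n : ℝ) ≤ alpha N := by exact_mod_cast alpha_mono h
      _ ≤ _ := le_mul_of_one_le_right (by linarith) ((Real.one_le_rpow hn1 hp).trans hpow)
  · obtain ⟨h1, h2⟩ := hN n h
    have hlog : 0 < Real.logb 2 (n : ℝ) :=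
      Real.logb_pos (by norm_num) (by exact_mod_cast h2)
    rw [div_lt_iff₀ hlog, ← Real.logb_rpow_eq_mul_logb_of_pos hn0,
      Real.logb_lt_logb_iff (by norm_num) (by exact_mod_cast alpha_pos n) (by positivity)] at h1
    exact (h1.le.trans hpow).trans (le_mul_of_one_le_left (by positivity) hC)

lemma exists_tendsto_beta :
    ∃ b : ℝ, Tendsto (fun n : ℕ => Real.logb 2 (beta n : ℝ) / (n : ℝ)) atTop (𝓝 b) := by
  have hsub : Subadditive fun n : ℕ => Real.logb 2 (beta n : ℝ) + Real.logb 2 3 := by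
    intro m n
    have := logb_le_of_le_three_mul (beta_pos _) (beta_pos _) (beta_pos _) (beta_add_le m n)
    linarith
  have h3 : 0 ≤ Real.logb 2 3 := Real.logb_nonneg (by norm_num) (by norm_num)
  have hlim := hsub.tendsto_lim ⟨0, by
    rintro _ ⟨t, rfl⟩
    exact div_nonneg (add_nonneg (logb_natCast_nonneg _) h3) (Nat.cast_nonneg _)⟩
  refine ⟨hsub.lim, ?_⟩
  have h := hlim.sub ((tendsto_inv_atTop_nhds_zero_nat (𝕜 := ℝ)).const_mul (Real.logb 2 3))
  rw [mul_zero, sub_zero] at h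
  refine h.congr fun n => ?_
  ring

lemma logb_beta_le (n : ℕ) : Real.logb 2 (beta n : ℝ) ≤ betaBound * n + 1 :=
  logb_le_of_le_growth_pow (by exact_mod_cast beta_pos n) (beta_le n)

lemma beta_limit_le {b : ℝ}
    (hb : Tendsto (fun n : ℕ => Real.logb 2 (beta n : ℝ) / (n : ℝ)) atTop (𝓝 b)) :
    b ≤ betaBound := by
  have h := ((tendsto_inv_atTop_nhds_zero_nat (𝕜 := ℝ)).const_add betaBound)
  rw [add_zero] at h
  refine le_of_tendsto_of_tendsto hb h ?_
  filter_upwards [eventually_ge_atTop 1] with n hn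
  have hn0 : (0 : ℝ) < n := by exact_mod_cast hn
  rw [div_le_iff₀ hn0, add_mul, inv_mul_cancel₀ hn0.ne']
  exact logb_beta_le n

/-! ### Decimal bounds -/

lemma div_le_logb_two {p q : ℕ} (hq : 0 < q) {r x : ℝ} (hr : 0 < r) (hrx : r ≤ x)
    (h : (2 : ℝ) ^ p ≤ r ^ q) : (p / q : ℝ) ≤ Real.logb 2 x := by
  have hq' : (0 : ℝ) < q := by exact_mod_cast hq
  rw [div_le_iff₀ hq', mul_comm, ← Real.logb_pow,
    Real.le_logb_iff_rpow_le (by norm_num) (by have := hr.trans_le hrx; positivity),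
    Real.rpow_natCast]
  exact h.trans (pow_le_pow_left₀ hr.le hrx q)

lemma logb_two_le_div {p q : ℕ} (hq : 0 < q) {r x : ℝ} (hx : 0 < x) (hrx : x ≤ r)
    (h : r ^ q ≤ 2 ^ p) : Real.logb 2 x ≤ (p / q : ℝ) := by
  have hq' : (0 : ℝ) < q := by exact_mod_cast hq
  rw [le_div_iff₀ hq', mul_comm, ← Real.logb_pow,
    Real.logb_le_iff_le_rpow (by norm_num) (by positivity), Real.rpow_natCast]
  exact (pow_le_pow_left₀ hx.le hrx q).trans h

set_option exponentiation.threshold 2000 in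
lemma betaBound_bounds : (1105 / 603 : ℝ) ≤ betaBound ∧ betaBound ≤ 372 / 203 := by
  have hg := growth_bounds
  rw [← logb_growth]
  constructor
  · exact_mod_cast div_le_logb_two (p := 1105) (q := 603) (by norm_num) (by norm_num) hg.1
      (by norm_num)
  · exact_mod_cast logb_two_le_div (p := 372) (q := 203) (by norm_num) (by linarith) hg.2
      (by norm_num)

set_option exponentiation.threshold 2000 in
lemma logb_one_add_sqrt_two_bounds :
    (295 / 232 : ℝ) ≤ Real.logb 2 (1 + √2) ∧ Real.logb 2 (1 + √2) ≤ 398 / 313 := by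
  have h1 : (1.414213 : ℝ) ≤ √2 := Real.le_sqrt_of_sq_le (by norm_num)
  have h2 : √2 ≤ 1.414214 := Real.sqrt_le_iff.2 (by norm_num)
  constructor
  · exact_mod_cast div_le_logb_two (p := 295) (q := 232) (r := 2.414213) (by norm_num)
      (by norm_num) (by linarith) (by norm_num)
  · exact_mod_cast logb_two_le_div (p := 398) (q := 313) (r := 2.414214) (by norm_num)
      (by linarith) (by linarith) (by norm_num)

lemma betaBound_decimal : 1.8325 ≤ betaBound ∧ betaBound < 1.8326 := by
  obtain ⟨h1, h2⟩ := betaBound_bounds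
  constructor
  · exact le_trans (by norm_num) h1
  · exact lt_of_le_of_lt h2 (by norm_num)

lemma alphaBound_decimal : 1.4411 ≤ alphaBound ∧ alphaBound < 1.4412 := by
  obtain ⟨h1, h2⟩ := betaBound_bounds
  obtain ⟨h3, h4⟩ := logb_one_add_sqrt_two_bounds
  have hpos : 0 < Real.logb 2 (1 + √2) := lt_of_lt_of_le (by norm_num) h3
  rw [alphaBound_eq, le_div_iff₀ hpos, div_lt_iff₀ hpos]
  constructor <;> linarith

/-! ### The growth rates -/

lemma logb_three_mul_le (n : ℕ) : Real.logb 2 3 * n ≤ Real.logb 2 (beta n : ℝ) := by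
  rw [mul_comm, ← Real.logb_pow]
  refine Real.logb_le_logb_of_le (by norm_num) (by positivity) ?_
  exact_mod_cast pow_three_le_beta n

lemma logb_three_le_beta_limit {b : ℝ}
    (hb : Tendsto (fun n : ℕ => Real.logb 2 (beta n : ℝ) / (n : ℝ)) atTop (nhds b)) :
    Real.logb 2 3 ≤ b := by
  refine ge_of_tendsto hb ?_
  filter_upwards [eventually_ge_atTop 1] with n hn
  have hn0 : (0 : ℝ) < n := by exact_mod_cast hn
  rw [le_div_iff₀ hn0]
  exact logb_three_mul_le n

end ShortElements

theorem theorem2p2 :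
    -- all the minima defining the two sequences are taken over nonempty sets
    (∀ n : ℕ, 1 ≤ n → ∃ w ∈ ShortElements.gamma n, w ≠ 1) ∧
    (∀ n : ℕ, ∃ w ∈ derivedSeries ShortElements.F2 n, w ≠ 1) ∧
    -- the lower central series
    (∃ a : ℝ,
      Tendsto (fun n : ℕ => Real.logb 2 (ShortElements.alpha n : ℝ) / Real.logb 2 (n : ℝ))
        atTop (nhds a) ∧
      a ≤ ShortElements.alphaBound) ∧
    (∀ ε : ℝ, 0 < ε →
      ShortElements.Preceq (fun n : ℕ => (ShortElements.alpha n : ℝ))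
        (fun n : ℕ => (n : ℝ) ^ (ShortElements.alphaBound + ε))) ∧
    -- the derived series
    (∃ b : ℝ,
      Tendsto (fun n : ℕ => Real.logb 2 (ShortElements.beta n : ℝ) / (n : ℝ)) atTop (nhds b) ∧
      Real.logb 2 3 ≤ b ∧ b ≤ ShortElements.betaBound) ∧
    (∀ n : ℕ, Real.logb 2 3 * n ≤ Real.logb 2 (ShortElements.beta n : ℝ)) ∧
    (∃ r : ℕ → ℝ, r =o[atTop] (fun n : ℕ => (n : ℝ)) ∧
      ∀ n : ℕ, Real.logb 2 (ShortElements.beta n : ℝ) ≤ ShortElements.betaBound * n + r n) ∧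
    -- the decimal expansions of the two bounds begin with 1.4411 and 1.8325
    (1.4411 ≤ ShortElements.alphaBound ∧ ShortElements.alphaBound < 1.4412) ∧
    (1.8325 ≤ ShortElements.betaBound ∧ ShortElements.betaBound < 1.8326) := by
  open ShortElements in
  obtain ⟨a, ha⟩ := exists_tendsto_alpha
  obtain ⟨b, hb⟩ := exists_tendsto_beta
  have haν := alpha_limit_le ha
  refine ⟨fun n _ => nontrivial_gamma n, nontrivial_derivedSeries, ⟨a, ha, haν⟩,
    fun ε hε => alpha_preceq hε ha haν (le_trans (by norm_num) alphaBound_decimal.1),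
    ⟨b, hb, logb_three_le_beta_limit hb, beta_limit_le hb⟩, logb_three_mul_le,
    ⟨fun _ => 1, ?_, logb_beta_le⟩, alphaBound_decimal, betaBound_decimal⟩
  exact (isLittleO_const_id_atTop (1 : ℝ)).comp_tendsto tendsto_natCast_atTop_atTop
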